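/- Let $V$ be a finite set with $n=|V|\ge 1$, and let $c_{xy}=c_{yx}\ge 0$ be real weights on the unordered pairs $\{x,y\}$ of distinct elements of $V$ (a weighted complete graph; an edge of weight $0$ counts as absent). Let $\mathcal X_n$ be the set of permutations of $V$, let $\nu$ be the uniform probability measure on $\mathcal X_n$, and write $\nu[g]=\int g\,d\nu$. For $y\neq z$ in $V$ let $\tau_{yz}\in\mathcal X_n$ be the transposition of $y$ and $z$, and for $f:\mathcal X_n\to\mathbb R$ and $\eta\in\mathcal X_n$ put $\nabla_{yz}f(\eta)=f(\eta\tau_{yz})-f(\eta)$. Then for every $x\in V$ and every $f:\mathcal X_n\to\mathbb R$, $$\sum_{y\in V\setminus\{x\}} c_{xy}\,\nu\big[(\nabla_{xy}f)^2\big]\;\ge\;\sum_{\{y,z\}\subset V\setminus\{x\},\ y\ne z} c^{*,x}_{yz}\,\nu\big[(\nabla_{yz}f)^2\big],\qquad c^{*,x}_{yz}=\frac{c_{xy}\,c_{xz}}{\sum_{w\in V\setminus\{x\}}c_{xw}},$$ where the sum on the right runs over unordered pairs, and $c^{*,x}_{yz}$ is read as $0$ if $c_{xw}=0$ for all $w\ne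 x$. -/

import Mathlib

/-- Edge weights (conductances) on the complete graph with vertex set `V`.  Weights may vanish;
an edge of weight zero is "absent".  The diagonal values `c x x` belong to no edge, are
unconstrained and are never used. -/
structure WeightedGraph (V : Type*) where
  /-- The weight `c x y` of the edge `{x, y}`. -/
  c : V → V → ℝ
  symm : ∀ x y, c x y = c y x
  nonneg : ∀ x y, x ≠ y → 0 ≤ c x y

namespace WeightedGraph

variable {V : Type*} [Fintype V] [DecidableEq V]

/-- The vertex set `V_x = V \ {x}` of the network reduced at `x`. -/
def reducedVertices (x : V) : Finset V := Finset.univ.erase x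

/-- The edge set `E_x`: all unordered pairs of distinct vertices, both different from `x`. -/
def reducedEdges (x : V) : Finset (Sym2 V) :=
  Finset.univ.filter fun e => ¬ e.IsDiag ∧ x ∉ e

/-- The extra conductance of the edge `{y, z}` created by removing the vertex `x`,
`c_{xy} c_{xz} / ∑_{w ∈ V_x} c_{xw}`.  (If all the weights at `x` are zero, it is `0`.) -/
noncomputable def cStar (G : WeightedGraph V) (x : V) : Sym2 V → ℝ :=
  Sym2.lift ⟨fun y z => G.c x y * G.c x z / ∑ w ∈ reducedVertices x, G.c x w,
    fun y z => by simp only [mul_comm (G.c x y)]⟩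

end WeightedGraph

namespace Interchange

variable {V : Type*} [DecidableEq V]

/-- The transposition attached to an unordered pair of vertices. -/
def transposition : Sym2 V → Equiv.Perm V :=
  Sym2.lift ⟨fun x y => Equiv.swap x y, fun x y => Equiv.swap_comm x y⟩

/-- The gradient of `f` along the edge `e = {x, y}`:
`η ↦ f (η τ_{xy}) - f η`, where `τ_{xy}` is the transposition of `x` and `y`. -/
def grad (e : Sym2 V) (f : Equiv.Perm V → ℝ) (η : Equiv.Perm V) : ℝ :=
  f (η * transposition e) - f η

variable [Fintype V]

/-- The uniform probability measure `ν` on the permutations of `V`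
(all sets of permutations being measurable). -/
noncomputable def unif (V : Type*) [Fintype V] [DecidableEq V] :
    @MeasureTheory.Measure (Equiv.Perm V) ⊤ :=
  letI : MeasurableSpace (Equiv.Perm V) := ⊤
  (PMF.uniformOfFintype (Equiv.Perm V)).toMeasure

/-- The expectation `ν[f] = ∫ f dν`. -/
noncomputable def expect (f : Equiv.Perm V → ℝ) : ℝ :=
  letI : MeasurableSpace (Equiv.Perm V) := ⊤
  ∫ η, f η ∂(unif V)

theorem expect_eq_average (f : Equiv.Perm V → ℝ) :
    expect f = (∑ η, f η) / (Fintype.card V).factorial := by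
  let _ : MeasurableSpace (Equiv.Perm V) := ⊤
  have : MeasurableSingletonClass (Equiv.Perm V) := ⟨fun _ => trivial⟩
  change ∫ η, f η ∂((PMF.uniformOfFintype (Equiv.Perm V)).toMeasure) = _
  rw [PMF.integral_eq_sum]
  simp [Fintype.card_perm, ← Finset.mul_sum, div_eq_inv_mul]

end Interchange

/-! Let A = ∑ c_i c_j τ_ij over ordered pairs (with τ_ii = 1) act on functions by right translation.
Taking c_y = c_xy for y ≠ x and c_x = -∑ c_xy, so that ∑ c_i = 0, the claim becomes ⟨f, A f⟩ ≥ 0,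
since each ν[(∇f)²] is a multiple of `corr f 1` minus the correlation along a transposition.

This follows from 0 ≤ ‖A f‖² ≤ 2 (∑ c_i²) ⟨f, A f⟩. The difference of the last two terms is, up to a
factor 3, the sum of c_i c_j c_k c_l `tetraForm f i j k l` over all quadruples
(`quadSum_tetraForm`): the three pairings of four indices contribute equally, and terms depending on
only three indices vanish because ∑ c_i = 0.

The sum is nonpositive (`quadSum_tetraForm_nonpos`): eliminating c_x leaves nonnegative weights on
quadruples avoiding x, times the difference of the two sides of `tetraForm_le`. That inequality and
`tetraForm_nonneg` are positivity statements in the group algebras of S₅ and S₄, where the relevant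
elements are positive multiples of projections. -/

open Equiv

namespace Interchange

/-! ### Correlations and positivity from the group algebra -/

section Correlation

variable {V : Type*} [Fintype V] [DecidableEq V]

/-- The correlation of `f` with its right translate by `g`. -/
def corr (f : Perm V → ℝ) (g : Perm V) : ℝ := ∑ η, f η * f (η * g)

theorem sum_translate_mul_translate (f : Perm V → ℝ) (g h : Perm V) :
    ∑ η, f (η * g) * f (η * h) = corr f (g⁻¹ * h) := by
  rw [corr, ← Equiv.sum_comp (Equiv.mulRight g) fun η => f η * f (η * (g⁻¹ * h))]
  simp [mul_assoc]

theorem corr_inv (f : Perm V → ℝ) (g : Perm V) : corr f g⁻¹ = corr f g := by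
  have h := sum_translate_mul_translate f g 1
  simp only [mul_one] at h
  rw [← h, corr]
  exact Finset.sum_congr rfl fun _ _ => mul_comm _ _

theorem corr_swap_mul_swap_comm (f : Perm V → ℝ) (i j k l : V) :
    corr f (swap i j * swap k l) = corr f (swap k l * swap i j) := by
  rw [← corr_inv, mul_inv_rev, swap_inv, swap_inv]

theorem sum_sq_translate_sub (f : Perm V → ℝ) (g : Perm V) :
    ∑ η, (f (η * g) - f η) ^ 2 = 2 * (corr f 1 - corr f g) := by
  have h1 := sum_translate_mul_translate f g g
  rw [inv_mul_cancel] at h1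
  have h2 : ∑ η, f η * f η = corr f 1 := by simp [corr]
  have h3 : ∀ η, (f (η * g) - f η) ^ 2 =
      f (η * g) * f (η * g) + f η * f η - 2 * (f η * f (η * g)) := fun _ => by ring
  simp only [h3, Finset.sum_sub_distrib, Finset.sum_add_distrib, ← Finset.mul_sum, h1, h2]
  rw [← corr]
  ring

/-- A self-adjoint group algebra element whose square is a positive multiple of itself has a
nonnegative quadratic form. -/
theorem sum_mul_corr_nonneg {H : Type*} [Group H] [Fintype H] (φ : H →* Perm V) (n : H → ℤ)
    {m : ℤ} (hm : 0 < m) (hn : ∀ g, ∑ h, n h * n (h * g) = m * n g) (f : Perm V → ℝ) :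
    0 ≤ ∑ h, (n h : ℝ) * corr f (φ h) := by
  -- The squared norm of n acting on f is the quadratic form of n*n, which `hn` identifies with m n.
  have key : ∑ η, (∑ h, (n h : ℝ) * f (η * φ h)) ^ 2 = m * ∑ h, (n h : ℝ) * corr f (φ h) := by
    calc ∑ η, (∑ h, (n h : ℝ) * f (η * φ h)) ^ 2
        = ∑ h, ∑ k, (n h : ℝ) * n k * corr f (φ (h⁻¹ * k)) := by
          simp only [sq, Finset.sum_mul_sum]
          rw [Finset.sum_comm]
          refine Finset.sum_congr rfl fun h _ => ?_
          rw [Finset.sum_comm]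
          refine Finset.sum_congr rfl fun k _ => ?_
          rw [map_mul, map_inv, ← sum_translate_mul_translate, Finset.mul_sum]
          exact Finset.sum_congr rfl fun _ _ => by ring
      _ = ∑ h, ∑ g, (n h : ℝ) * n (h * g) * corr f (φ g) := by
          refine Finset.sum_congr rfl fun h _ => ?_
          rw [← Equiv.sum_comp (Equiv.mulLeft h)]
          simp
      _ = m * ∑ h, (n h : ℝ) * corr f (φ h) := by
          rw [Finset.sum_comm, Finset.mul_sum]
          refine Finset.sum_congr rfl fun g _ => ?_
          have := congrArg (Int.cast : ℤ → ℝ) (hn g)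
          push_cast at this
          rw [← Finset.sum_mul, this, mul_assoc]
  have h0 : (0 : ℝ) ≤ m * ∑ h, (n h : ℝ) * corr f (φ h) :=
    key ▸ Finset.sum_nonneg fun _ _ => sq_nonneg _
  exact nonneg_of_mul_nonneg_right h0 (by exact_mod_cast hm)

theorem sum_coeff_mul {H R : Type*} [Fintype H] [DecidableEq H] [CommRing R]
    (L : List (ℤ × H)) (F : H → R) :
    ∑ h, (((L.map fun q => if q.2 = h then q.1 else 0).sum : ℤ) : R) * F h =
      (L.map fun q => (q.1 : R) * F q.2).sum := by
  induction L with
  | nil => simp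
  | cons q L ih =>
    simp only [List.map_cons, List.sum_cons, Int.cast_add, add_mul, Finset.sum_add_distrib, ih]
    simp

/-- Version for sparse elements: the convolution identity is tested by summing over the listed
support only, which keeps the finite check small. -/
theorem list_corr_nonneg {H : Type*} [Group H] [Fintype H] [DecidableEq H] (φ : H →* Perm V)
    (L : List (ℤ × H)) (n : H → ℤ)
    (hL : ∀ h, n h = (L.map fun q => if q.2 = h then q.1 else 0).sum)
    {m : ℤ} (hm : 0 < m) (hn : ∀ g, (L.map fun q => q.1 * n (q.2 * g)).sum = m * n g)
    (f : Perm V → ℝ) :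
    0 ≤ (L.map fun q => (q.1 : ℝ) * corr f (φ q.2)).sum := by
  rw [← sum_coeff_mul L fun h => corr f (φ h)]
  simp only [← hL]
  refine sum_mul_corr_nonneg φ n hm (fun g => ?_) f
  rw [← hn g]
  have := sum_coeff_mul L fun h => n (h * g)
  simpa only [← hL, Int.cast_id] using this

theorem viaEmbeddingHom_swap {α β : Type*} [DecidableEq α] [DecidableEq β] (ι : α ↪ β) (a b : α) :
    Perm.viaEmbeddingHom ι (swap a b) = swap (ι a) (ι b) := by
  ext y
  rw [Perm.viaEmbeddingHom_apply]
  by_cases hy : y ∈ Set.range ι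
  · obtain ⟨z, rfl⟩ := hy
    rw [Perm.viaEmbedding_apply, ι.injective.map_swap]
  · rw [Perm.viaEmbedding_apply_of_notMem _ _ _ hy, swap_apply_of_ne_of_ne]
    · rintro rfl; exact hy ⟨a, rfl⟩
    · rintro rfl; exact hy ⟨b, rfl⟩

end Correlation

/-! ### Two positive elements in the group algebras of S₄ and S₅ -/

section SmallSymmetricGroups

/-- Twice the sum over the Klein four-group minus the sum of the 3-cycles, in the group algebra
of the permutations of four points. -/
def tetraElement : List (ℤ × Perm (Fin 4)) :=
  [(2, 1), (2, swap 0 1 * swap 2 3), (2, swap 0 2 * swap 1 3), (2, swap 0 3 * swap 1 2),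
    (-1, swap 0 1 * swap 1 2), (-1, swap 1 2 * swap 0 1),
    (-1, swap 0 1 * swap 1 3), (-1, swap 1 3 * swap 0 1),
    (-1, swap 0 2 * swap 2 3), (-1, swap 2 3 * swap 0 2),
    (-1, swap 1 2 * swap 2 3), (-1, swap 2 3 * swap 1 2)]

/-- The sum of the five embeddings of `tetraElement` into the group algebra of the permutations
of five points, with a minus sign for the one that fixes the last point. -/
def pentaElement : List (ℤ × Perm (Fin 5)) :=
  [(6, 1), (2, swap 0 1 * swap 2 4), (2, swap 0 1 * swap 3 4), (2, swap 0 2 * swap 1 4),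
    (2, swap 0 2 * swap 3 4), (2, swap 0 3 * swap 1 4), (2, swap 0 3 * swap 2 4),
    (2, swap 0 4 * swap 1 2), (2, swap 1 2 * swap 3 4), (2, swap 0 4 * swap 1 3),
    (2, swap 1 3 * swap 2 4), (2, swap 0 4 * swap 2 3), (2, swap 1 4 * swap 2 3),
    (-2, swap 0 1 * swap 2 3), (-2, swap 0 2 * swap 1 3), (-2, swap 0 3 * swap 1 2),
    (-2, swap 0 1 * swap 1 4), (-2, swap 1 4 * swap 0 1),
    (-2, swap 0 2 * swap 2 4), (-2, swap 2 4 * swap 0 2),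
    (-2, swap 0 3 * swap 3 4), (-2, swap 3 4 * swap 0 3),
    (-2, swap 1 2 * swap 2 4), (-2, swap 2 4 * swap 1 2),
    (-2, swap 1 3 * swap 3 4), (-2, swap 3 4 * swap 1 3),
    (-2, swap 2 3 * swap 3 4), (-2, swap 3 4 * swap 2 3)]

/-- The coefficients of `tetraElement`, as a function of the four values of a permutation. -/
def tetraCoeff (a b c d : Fin 4) : ℤ :=
  let t := fun x y : Fin 4 => decide (x < y)
  -- The number of non-inverted pairs out of six has the parity of the permutation, so odd
  -- permutations get 0. Among even ones, exactly the 3-cycles have one fixed point.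
  bif ((t a b ^^ t a c) ^^ (t a d ^^ t b c)) ^^ (t b d ^^ t c d) then 0 else
    match [decide (a = 0), decide (b = 1), decide (c = 2), decide (d = 3)].count true with
    | 1 => -1
    | _ => 2

/-- The coefficients of `pentaElement`, as a function of the five values of a permutation. -/
def pentaCoeff (a b c d e : Fin 5) : ℤ :=
  let t := fun x y : Fin 5 => decide (x < y)
  -- Parity again, now over ten pairs. Even permutations with 5, 2, 1, 0 fixed points are the
  -- identity, 3-cycles, double transpositions and 5-cycles.
  bif (((t a b ^^ t a c) ^^ (t a d ^^ t a e)) ^^ ((t b c ^^ t b d) ^^ (t b e ^^ t c d))) ^^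
      (t c e ^^ t d e) then 0 else
    match [decide (a = 0), decide (b = 1), decide (c = 2), decide (d = 3),
      decide (e = 4)].count true with
    | 5 => 6
    | 1 => bif e == 4 then -2 else 2
    | 2 => bif e == 4 then 0 else -2
    | _ => 0

set_option maxRecDepth 100000

/-- Quantifying over value tuples, with distinctness imposed as early as possible, makes this a
cheap kernel computation. The second part says that the element squares to 12 times itself. -/
theorem tetraCoeff_spec : ∀ a b : Fin 4, a ≠ b → ∀ c, (c ≠ a ∧ c ≠ b) →
    ∀ d, (d ≠ a ∧ d ≠ b ∧ d ≠ c) →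
    tetraCoeff a b c d = (tetraElement.map fun q =>
        if q.2 0 = a ∧ q.2 1 = b ∧ q.2 2 = c ∧ q.2 3 = d then q.1 else 0).sum ∧
      (tetraElement.map fun q => q.1 * tetraCoeff (q.2 a) (q.2 b) (q.2 c) (q.2 d)).sum =
        12 * tetraCoeff a b c d := by
  decide +kernel

theorem pentaCoeff_spec : ∀ a b : Fin 5, a ≠ b → ∀ c, (c ≠ a ∧ c ≠ b) →
    ∀ d, (d ≠ a ∧ d ≠ b ∧ d ≠ c) → ∀ e, (e ≠ a ∧ e ≠ b ∧ e ≠ c ∧ e ≠ d) →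
    pentaCoeff a b c d e = (pentaElement.map fun q =>
        if q.2 0 = a ∧ q.2 1 = b ∧ q.2 2 = c ∧ q.2 3 = d ∧ q.2 4 = e then q.1 else 0).sum ∧
      (pentaElement.map fun q =>
        q.1 * pentaCoeff (q.2 a) (q.2 b) (q.2 c) (q.2 d) (q.2 e)).sum =
        24 * pentaCoeff a b c d e := by
  decide +kernel

variable {V : Type*} [Fintype V] [DecidableEq V]

theorem tetraElement_corr_nonneg (φ : Perm (Fin 4) →* Perm V) (f : Perm V → ℝ) :
    0 ≤ (tetraElement.map fun q => (q.1 : ℝ) * corr f (φ q.2)).sum := by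
  have spec (g : Perm (Fin 4)) := tetraCoeff_spec (g 0) (g 1) (by simp) (g 2) (by simp)
    (g 3) (by simp)
  refine list_corr_nonneg φ tetraElement (fun g => tetraCoeff (g 0) (g 1) (g 2) (g 3))
    (fun h => ?_) (m := 12) (by norm_num) (fun g => (spec g).2) f
  rw [(spec h).1]
  simp only [Perm.ext_iff, Fin.forall_fin_succ]
  simp

theorem pentaElement_corr_nonneg (φ : Perm (Fin 5) →* Perm V) (f : Perm V → ℝ) :
    0 ≤ (pentaElement.map fun q => (q.1 : ℝ) * corr f (φ q.2)).sum := by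
  have spec (g : Perm (Fin 5)) := pentaCoeff_spec (g 0) (g 1) (by simp) (g 2) (by simp)
    (g 3) (by simp) (g 4) (by simp)
  refine list_corr_nonneg φ pentaElement
    (fun g => pentaCoeff (g 0) (g 1) (g 2) (g 3) (g 4))
    (fun h => ?_) (m := 24) (by norm_num) (fun g => (spec g).2) f
  rw [(spec h).1]
  simp only [Perm.ext_iff, Fin.forall_fin_succ]
  simp

end SmallSymmetricGroups
end Interchange

/-! ### The form attached to four points, and its comparison over five points -/

namespace Interchange
theorem swap_mul_swap_rotate {V : Type*} [DecidableEq V] {i j k : V} (hij : i ≠ j) (hik : i ≠ k) :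
    swap i j * swap j k = swap j k * swap k i := by
  rw [swap_mul_eq_mul_swap, swap_inv, swap_apply_of_ne_of_ne hij hik, swap_apply_left,
    swap_comm i k]

section Quadruples

variable {V : Type*} [Fintype V] [DecidableEq V]

/-- The correlation of `f` along the 3-cycle through `i`, `j`, `k`, with a convenient value when
these are not distinct. -/
noncomputable def cycleCorr (f : Perm V → ℝ) (i j k : V) : ℝ :=
  if i = j ∧ j = k then -(corr f 1) / 2
  else if i = j ∨ j = k ∨ i = k then corr f 1 / 2
  else corr f (swap i j * swap j k)

theorem cycleCorr_of_ne (f : Perm V → ℝ) {i j k : V} (hij : i ≠ j) (hjk : j ≠ k) (hik : i ≠ k) :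
    cycleCorr f i j k = corr f (swap i j * swap j k) := by
  simp [cycleCorr, hij, hjk, hik]

theorem cycleCorr_reverse (f : Perm V → ℝ) (i j k : V) :
    cycleCorr f i j k = cycleCorr f k j i := by
  unfold cycleCorr
  rw [corr_swap_mul_swap_comm, swap_comm j k, swap_comm i j]
  grind

theorem cycleCorr_rotate (f : Perm V → ℝ) (i j k : V) :
    cycleCorr f i j k = cycleCorr f j k i := by
  by_cases h : i ≠ j ∧ j ≠ k ∧ i ≠ k
  · rw [cycleCorr_of_ne f h.1 h.2.1 h.2.2, cycleCorr_of_ne f h.2.1 h.2.2.symm h.1.symm,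
      swap_mul_swap_rotate h.1 h.2.2]
  · unfold cycleCorr
    grind

theorem cycleCorr_swap (f : Perm V → ℝ) (i j k : V) :
    cycleCorr f i j k = cycleCorr f j i k := by
  rw [cycleCorr_rotate, cycleCorr_reverse, cycleCorr_rotate, cycleCorr_rotate]

/-- The correlation of `f` along a pair of transpositions, corrected where two pairs touch. -/
noncomputable def pairCorr (f : Perm V → ℝ) (i j k l : V) : ℝ :=
  corr f (swap i j * swap k l) - (if i = j then corr f (swap k l) else 0) -
    (if k = l then corr f (swap i j) else 0)

/-- For distinct points, half the quadratic form of the group algebra element `tetraElement`. -/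
noncomputable def tetraForm (f : Perm V → ℝ) (i j k l : V) : ℝ :=
  pairCorr f i j k l + pairCorr f i k j l + pairCorr f i l j k + corr f 1 -
    cycleCorr f i j k - cycleCorr f i j l - cycleCorr f i k l - cycleCorr f j k l

theorem tetraForm_swap₁₂ (f : Perm V → ℝ) (i j k l : V) :
    tetraForm f i j k l = tetraForm f j i k l := by
  have h1 := corr_swap_mul_swap_comm f i k j l
  have h2 := corr_swap_mul_swap_comm f i l j k
  rw [tetraForm, tetraForm, cycleCorr_swap f i j k, cycleCorr_swap f i j l]
  simp only [pairCorr, h1, h2, swap_comm j i, eq_comm (a := j) (b := i)]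
  ring

theorem tetraForm_swap₂₃ (f : Perm V → ℝ) (i j k l : V) :
    tetraForm f i j k l = tetraForm f i k j l := by
  have h : cycleCorr f i j k = cycleCorr f i k j := by
    rw [cycleCorr_rotate, cycleCorr_swap, cycleCorr_rotate, cycleCorr_rotate]
  rw [tetraForm, tetraForm, h, cycleCorr_swap f j k l]
  simp only [pairCorr, swap_comm k j, eq_comm (a := k) (b := j)]
  ring

theorem tetraForm_swap₃₄ (f : Perm V → ℝ) (i j k l : V) :
    tetraForm f i j k l = tetraForm f i j l k := by
  have h (a : V) : cycleCorr f a k l = cycleCorr f a l k := by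
    rw [cycleCorr_rotate, cycleCorr_swap, cycleCorr_rotate, cycleCorr_rotate]
  rw [tetraForm, tetraForm, h, h]
  simp only [pairCorr, swap_comm l k, eq_comm (a := l) (b := k)]
  ring

/-- The degenerate values of `cycleCorr` are chosen to make this true. They cost nothing, because
every cycle term drops out of `quadSum` when ∑ c_i = 0; the corrections in `pairCorr` survive there
and produce the term in ∑ c_i². -/
theorem tetraForm_self (f : Perm V → ℝ) (i k l : V) : tetraForm f i i k l = 0 := by
  have hs (a : V) : swap a a = (1 : Perm V) := swap_self a
  by_cases hik : i = k
  · subst hik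
    by_cases hil : i = l
    · simp [tetraForm, pairCorr, cycleCorr, hil, hs, -swap_self]; ring_nf
    · simp [tetraForm, pairCorr, cycleCorr, hil, hs, -swap_self]; ring_nf
  by_cases hil : i = l
  · subst hil
    simp [tetraForm, pairCorr, cycleCorr, hik, Ne.symm hik, swap_comm k i, hs, -swap_self]; ring_nf
  by_cases hkl : k = l
  · subst hkl
    simp [tetraForm, pairCorr, cycleCorr, hik, hs, -swap_self]; ring_nf
  · rw [tetraForm, cycleCorr_swap f i k l, cycleCorr_of_ne f (Ne.symm hik) hil hkl]
    simp [pairCorr, cycleCorr, hik, hil, hkl, swap_comm k i, corr_swap_mul_swap_comm f i l i k,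
      hs, -swap_self]
    ring

theorem tetraForm_eq_zero (f : Perm V → ℝ) {i j k l : V}
    (h : ¬ (i ≠ j ∧ i ≠ k ∧ i ≠ l ∧ j ≠ k ∧ j ≠ l ∧ k ≠ l)) : tetraForm f i j k l = 0 := by
  by_cases h1 : i = j
  · rw [h1, tetraForm_self]
  by_cases h2 : i = k
  · rw [tetraForm_swap₂₃, h2, tetraForm_self]
  by_cases h3 : i = l
  · rw [tetraForm_swap₃₄, tetraForm_swap₂₃, h3, tetraForm_self]
  by_cases h4 : j = k
  · rw [tetraForm_swap₁₂, tetraForm_swap₂₃, h4, tetraForm_self]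
  by_cases h5 : j = l
  · rw [tetraForm_swap₁₂, tetraForm_swap₃₄, tetraForm_swap₂₃, h5, tetraForm_self]
  by_cases h6 : k = l
  · rw [tetraForm_swap₂₃, tetraForm_swap₁₂, tetraForm_swap₃₄, tetraForm_swap₂₃, h6,
      tetraForm_self]
  exact absurd ⟨h1, h2, h3, h4, h5, h6⟩ h

theorem tetraForm_nonneg (f : Perm V → ℝ) (i j k l : V) : 0 ≤ tetraForm f i j k l := by
  by_cases h : i ≠ j ∧ i ≠ k ∧ i ≠ l ∧ j ≠ k ∧ j ≠ l ∧ k ≠ l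
  · obtain ⟨h1, h2, h3, h4, h5, h6⟩ := h
    let ι : Fin 4 ↪ V := ⟨![i, j, k, l], by
      intro a b; fin_cases a <;> fin_cases b <;> simp_all [eq_comm]⟩
    have key := tetraElement_corr_nonneg (Perm.viaEmbeddingHom ι) f
    have e0 : ι 0 = i := rfl
    have e1 : ι 1 = j := rfl
    have e2 : ι 2 = k := rfl
    have e3 : ι 3 = l := rfl
    simp only [tetraElement, List.map_cons, List.map_nil, List.sum_cons, List.sum_nil, map_mul,
      map_one, viaEmbeddingHom_swap, e0, e1, e2, e3] at key
    have r1 := corr_swap_mul_swap_comm f i j j k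
    have r2 := corr_swap_mul_swap_comm f i j j l
    have r3 := corr_swap_mul_swap_comm f i k k l
    have r4 := corr_swap_mul_swap_comm f j k k l
    rw [tetraForm, cycleCorr_of_ne f h1 h4 h2, cycleCorr_of_ne f h1 h5 h3,
      cycleCorr_of_ne f h2 h6 h3, cycleCorr_of_ne f h4 h6 h5]
    simp only [pairCorr, h1, h2, h3, h4, h5, h6, if_false]
    push_cast at key
    linarith
  · rw [tetraForm_eq_zero f h]

/-- For distinct points, right side minus left side is half the quadratic form of `pentaElement`,
with x as last point. Otherwise the left side is 0. -/
theorem tetraForm_le (f : Perm V → ℝ) {i j k l x : V} (hi : i ≠ x) (hj : j ≠ x) (hk : k ≠ x)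
    (hl : l ≠ x) : tetraForm f i j k l ≤
      tetraForm f x j k l + tetraForm f i x k l + tetraForm f i j x l + tetraForm f i j k x := by
  by_cases h : i ≠ j ∧ i ≠ k ∧ i ≠ l ∧ j ≠ k ∧ j ≠ l ∧ k ≠ l
  · obtain ⟨h1, h2, h3, h4, h5, h6⟩ := h
    rw [tetraForm_swap₃₄ f i j x l, tetraForm_swap₂₃ f i x k l, tetraForm_swap₃₄ f i k x l,
      tetraForm_swap₁₂ f x j k l, tetraForm_swap₂₃ f j x k l, tetraForm_swap₃₄ f j k x l]
    let ι : Fin 5 ↪ V := ⟨![i, j, k, l, x], by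
      intro a b; fin_cases a <;> fin_cases b <;> simp_all [eq_comm]⟩
    have key := pentaElement_corr_nonneg (Perm.viaEmbeddingHom ι) f
    have e0 : ι 0 = i := rfl
    have e1 : ι 1 = j := rfl
    have e2 : ι 2 = k := rfl
    have e3 : ι 3 = l := rfl
    have e4 : ι 4 = x := rfl
    simp only [pentaElement, List.map_cons, List.map_nil, List.sum_cons, List.sum_nil, map_mul,
      map_one, viaEmbeddingHom_swap, e0, e1, e2, e3, e4] at key
    have r1 := corr_swap_mul_swap_comm f i j j x
    have r2 := corr_swap_mul_swap_comm f i k k x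
    have r3 := corr_swap_mul_swap_comm f i l l x
    have r4 := corr_swap_mul_swap_comm f j k k x
    have r5 := corr_swap_mul_swap_comm f j l l x
    have r6 := corr_swap_mul_swap_comm f k l l x
    simp only [tetraForm, cycleCorr_of_ne f h1 h4 h2, cycleCorr_of_ne f h1 h5 h3,
      cycleCorr_of_ne f h2 h6 h3, cycleCorr_of_ne f h4 h6 h5, cycleCorr_of_ne f h1 hj hi,
      cycleCorr_of_ne f h2 hk hi, cycleCorr_of_ne f h3 hl hi, cycleCorr_of_ne f h4 hk hj,
      cycleCorr_of_ne f h5 hl hj, cycleCorr_of_ne f h6 hl hk]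
    simp only [pairCorr, h1, h2, h3, h4, h5, h6, hi, hj, hk, hl, if_false]
    push_cast at key
    linarith [corr_swap_mul_swap_comm f i x j k, corr_swap_mul_swap_comm f i x j l,
      corr_swap_mul_swap_comm f i x k l, corr_swap_mul_swap_comm f j x k l]
  · rw [tetraForm_eq_zero f h]
    have := tetraForm_nonneg f x j k l
    have := tetraForm_nonneg f i x k l
    have := tetraForm_nonneg f i j x l
    have := tetraForm_nonneg f i j k x
    linarith

end Quadruples
end Interchange

/-! ### Weighted sums over quadruples -/

section QuadSum

variable {V : Type*} [Fintype V]

/-- The weighted sum of `G` over all quadruples. -/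
def quadSum (c : V → ℝ) (G : V → V → V → V → ℝ) : ℝ :=
  ∑ i, ∑ j, ∑ k, ∑ l, c i * c j * c k * c l * G i j k l

theorem quadSum_add (c : V → ℝ) (G H : V → V → V → V → ℝ) :
    quadSum c (fun i j k l => G i j k l + H i j k l) = quadSum c G + quadSum c H := by
  simp only [quadSum, mul_add, Finset.sum_add_distrib]

theorem quadSum_sub (c : V → ℝ) (G H : V → V → V → V → ℝ) :
    quadSum c (fun i j k l => G i j k l - H i j k l) = quadSum c G - quadSum c H := by
  simp only [quadSum, mul_sub, Finset.sum_sub_distrib]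

theorem quadSum_swap₁₂ (c : V → ℝ) (G : V → V → V → V → ℝ) :
    quadSum c (fun i j k l => G j i k l) = quadSum c G := by
  unfold quadSum
  rw [Finset.sum_comm]
  simp only [mul_comm (c _) (c _)]

theorem quadSum_swap₂₃ (c : V → ℝ) (G : V → V → V → V → ℝ) :
    quadSum c (fun i j k l => G i k j l) = quadSum c G := by
  unfold quadSum
  refine Finset.sum_congr rfl fun i _ => ?_
  rw [Finset.sum_comm]
  simp only [mul_right_comm (c i) (c _) (c _)]

theorem quadSum_swap₃₄ (c : V → ℝ) (G : V → V → V → V → ℝ) :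
    quadSum c (fun i j k l => G i j l k) = quadSum c G := by
  unfold quadSum
  refine Finset.sum_congr rfl fun i _ => Finset.sum_congr rfl fun j _ => ?_
  rw [Finset.sum_comm]
  simp only [mul_right_comm (c i * c j) (c _) (c _)]

theorem quadSum_eq_zero {c : V → ℝ} (hc : ∑ i, c i = 0) (G : V → V → V → ℝ) :
    quadSum c (fun i j k _ => G i j k) = 0 := by
  simp only [quadSum, ← Finset.mul_sum, ← Finset.sum_mul, hc, mul_zero, zero_mul,
    Finset.sum_const_zero]

theorem quadSum_mul (c : V → ℝ) (A B : V → V → ℝ) :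
    quadSum c (fun i j k l => A i j * B k l) =
      (∑ i, ∑ j, c i * c j * A i j) * ∑ i, ∑ j, c i * c j * B i j := by
  simp only [quadSum, Finset.sum_mul]
  simp only [Finset.mul_sum]
  refine Finset.sum_congr rfl fun i _ => Finset.sum_congr rfl fun j _ =>
    Finset.sum_congr rfl fun k _ => Finset.sum_congr rfl fun l _ => by ring

theorem sum_mul_eq_sum_erase [DecidableEq V] {c : V → ℝ} (hc : ∑ i, c i = 0) (x : V) (g : V → ℝ) :
    ∑ i, c i * g i = ∑ i ∈ Finset.univ.erase x, c i * (g i - g x) := by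
  rw [Finset.sum_erase _ (by simp)]
  simp only [mul_sub, Finset.sum_sub_distrib, ← Finset.sum_mul, hc]
  ring

end QuadSum

/-! ### The symmetric octopus inequality -/

namespace Interchange

variable {V : Type*} [Fintype V] [DecidableEq V]

theorem quadSum_tetraForm_nonpos (f : Perm V → ℝ) {c : V → ℝ} (hc : ∑ i, c i = 0) (x : V)
    (hx : ∀ y, y ≠ x → 0 ≤ c y) : quadSum c (tetraForm f) ≤ 0 := by
  have hswap (i j k l : V) (h : ¬ (i ≠ j ∧ i ≠ k ∧ i ≠ l ∧ j ≠ k ∧ j ≠ l ∧ k ≠ l)) :=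
    tetraForm_eq_zero f h
  have expand : quadSum c (tetraForm f) =
      ∑ i, c i * ∑ j, c j * ∑ k, c k * ∑ l, c l * tetraForm f i j k l := by
    simp only [quadSum, Finset.mul_sum, mul_assoc]
  rw [expand]
  -- Eliminating c_x in all four positions gives an alternating sum of 16 forms; the 11 in which x
  -- occurs at least twice vanish.
  simp only [sum_mul_eq_sum_erase hc x]
  simp only [← Finset.sum_sub_distrib, ← mul_sub]
  refine Finset.sum_nonpos fun i hi => mul_nonpos_of_nonneg_of_nonpos
    (hx i (Finset.ne_of_mem_erase hi)) (Finset.sum_nonpos fun j hj =>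
    mul_nonpos_of_nonneg_of_nonpos (hx j (Finset.ne_of_mem_erase hj))
    (Finset.sum_nonpos fun k hk => mul_nonpos_of_nonneg_of_nonpos
    (hx k (Finset.ne_of_mem_erase hk)) (Finset.sum_nonpos fun l hl =>
    mul_nonpos_of_nonneg_of_nonpos (hx l (Finset.ne_of_mem_erase hl)) ?_)))
  rw [hswap i j x x (by simp), hswap i x k x (by simp), hswap i x x l (by simp),
    hswap i x x x (by simp), hswap x j k x (by simp), hswap x j x l (by simp),
    hswap x j x x (by simp), hswap x x k l (by simp), hswap x x k x (by simp),
    hswap x x x l (by simp), hswap x x x x (by simp)]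
  linarith [tetraForm_le f (Finset.ne_of_mem_erase hi) (Finset.ne_of_mem_erase hj)
    (Finset.ne_of_mem_erase hk) (Finset.ne_of_mem_erase hl)]

theorem quadSum_tetraForm (f : Perm V → ℝ) {c : V → ℝ} (hc : ∑ i, c i = 0) :
    quadSum c (tetraForm f) = 3 * (∑ η, (∑ i, ∑ j, c i * c j * f (η * swap i j)) ^ 2 -
      2 * (∑ i, c i ^ 2) * ∑ i, ∑ j, c i * c j * corr f (swap i j)) := by
  have hP : quadSum c (fun i j k l => corr f (swap i j * swap k l)) =
      ∑ η, (∑ i, ∑ j, c i * c j * f (η * swap i j)) ^ 2 := by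
    have h (η : Perm V) : (∑ i, ∑ j, c i * c j * f (η * swap i j)) ^ 2 =
        quadSum c (fun i j k l => f (η * swap i j) * f (η * swap k l)) := by
      rw [quadSum_mul, sq]
    simp only [h, quadSum]
    symm
    rw [Finset.sum_comm]
    refine Finset.sum_congr rfl fun i _ => ?_
    rw [Finset.sum_comm]
    refine Finset.sum_congr rfl fun j _ => ?_
    rw [Finset.sum_comm]
    refine Finset.sum_congr rfl fun k _ => ?_
    rw [Finset.sum_comm]
    refine Finset.sum_congr rfl fun l _ => ?_
    rw [← Finset.mul_sum, sum_translate_mul_translate, swap_inv]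
  -- The diagonal corrections in `pairCorr` factor through this sum.
  have hD : ∑ i, ∑ j, c i * c j * (if i = j then 1 else 0 : ℝ) = ∑ i, c i ^ 2 := by
    simp [sq]
  have hR : quadSum c (pairCorr f) = ∑ η, (∑ i, ∑ j, c i * c j * f (η * swap i j)) ^ 2 -
      2 * (∑ i, c i ^ 2) * ∑ i, ∑ j, c i * c j * corr f (swap i j) := by
    have h : pairCorr f = fun i j k l => corr f (swap i j * swap k l) -
        (if i = j then 1 else 0) * corr f (swap k l) -
        corr f (swap i j) * (if k = l then 1 else 0) := by
      funext i j k l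
      simp [pairCorr]
    rw [h, quadSum_sub, quadSum_sub, hP, quadSum_mul, quadSum_mul, hD]
    ring
  have hR2 : quadSum c (fun i j k l => pairCorr f i k j l) = quadSum c (pairCorr f) :=
    quadSum_swap₂₃ c _
  have hR3 : quadSum c (fun i j k l => pairCorr f i l j k) = quadSum c (pairCorr f) :=
    (quadSum_swap₃₄ c fun i j k l => pairCorr f i k j l).trans hR2
  have z1 : quadSum c (fun _ _ _ _ => corr f 1) = 0 := quadSum_eq_zero hc fun _ _ _ => corr f 1
  have z2 : quadSum c (fun i j k _ => cycleCorr f i j k) = 0 := quadSum_eq_zero hc (cycleCorr f)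
  have z3 : quadSum c (fun i j _ l => cycleCorr f i j l) = 0 :=
    (quadSum_swap₃₄ c fun i j k _ => cycleCorr f i j k).trans z2
  have z4 : quadSum c (fun i _ k l => cycleCorr f i k l) = 0 :=
    (quadSum_swap₂₃ c fun i j _ l => cycleCorr f i j l).trans z3
  have z5 : quadSum c (fun _ j k l => cycleCorr f j k l) = 0 :=
    (quadSum_swap₁₂ c fun i _ k l => cycleCorr f i k l).trans z4
  have hT : tetraForm f = fun i j k l => pairCorr f i j k l + pairCorr f i k j l +
      pairCorr f i l j k + corr f 1 - cycleCorr f i j k - cycleCorr f i j l - cycleCorr f i k l -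
      cycleCorr f j k l := rfl
  rw [hT, quadSum_sub, quadSum_sub, quadSum_sub, quadSum_sub, quadSum_add, quadSum_add,
    quadSum_add, hR2, hR3, z1, z2, z3, z4, z5]
  change quadSum c (pairCorr f) + _ + _ + _ - _ - _ - _ - _ = _
  rw [hR]
  ring

/-- The symmetric form of the octopus inequality. -/
theorem sum_mul_corr_swap_nonneg (f : Perm V → ℝ) {c : V → ℝ} (hc : ∑ i, c i = 0) (x : V)
    (hx : ∀ y, y ≠ x → 0 ≤ c y) : 0 ≤ ∑ i, ∑ j, c i * c j * corr f (swap i j) := by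
  have h1 := quadSum_tetraForm_nonpos f hc x hx
  rw [quadSum_tetraForm f hc] at h1
  have h2 : 0 ≤ ∑ η, (∑ i, ∑ j, c i * c j * f (η * swap i j)) ^ 2 :=
    Finset.sum_nonneg fun _ _ => sq_nonneg _
  have h3 : 0 ≤ ∑ i, c i ^ 2 := Finset.sum_nonneg fun _ _ => sq_nonneg _
  rcases h3.eq_or_lt with h0 | h0
  · have h4 (i : V) : c i = 0 := by
      have := (Finset.sum_eq_zero_iff_of_nonneg fun i _ => sq_nonneg (c i)).1 h0.symm i
      simpa using this
    simp [h4]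
  · exact nonneg_of_mul_nonneg_right (a := ∑ i, c i ^ 2) (by linarith) h0

/-! ### Return to edges and expectations -/

/-- A sum over ordered pairs of vertices different from `x` counts every reduced edge twice. -/
theorem sum_reducedEdges (x : V) (h : Sym2 V → ℝ) (hd : ∀ y, h s(y, y) = 0) :
    ∑ y ∈ Finset.univ.erase x, ∑ z ∈ Finset.univ.erase x, h s(y, z) =
      2 * ∑ e ∈ WeightedGraph.reducedEdges x, h e := by
  set S : Finset V := Finset.univ.erase x
  have h1 : ∑ y ∈ S, ∑ z ∈ S, h s(y, z) = ∑ p ∈ S.offDiag, h s(p.1, p.2) := by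
    rw [← Finset.sum_product' S S fun y z => h s(y, z), ← Finset.diag_union_offDiag,
      Finset.sum_union (Finset.disjoint_diag_offDiag S), Finset.sum_diag]
    simp [hd]
  rw [h1, ← Finset.sum_fiberwise_of_maps_to (g := fun p : V × V => s(p.1, p.2))
    (t := WeightedGraph.reducedEdges x), Finset.mul_sum]
  · refine Finset.sum_congr rfl fun e he => ?_
    induction e with | _ a b =>
    simp only [WeightedGraph.reducedEdges, Finset.mem_filter, Finset.mem_univ, true_and,
      Sym2.mk_isDiag_iff, Sym2.mem_iff, not_or] at he
    have hf : S.offDiag.filter (fun p => s(p.1, p.2) = s(a, b)) = {(a, b), (b, a)} := by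
      ext ⟨y, z⟩
      simp only [Finset.mem_filter, Finset.mem_offDiag, Finset.mem_insert, Finset.mem_singleton,
        Sym2.eq_iff, Prod.mk.injEq, S, Finset.mem_erase, Finset.mem_univ, and_true]
      grind
    rw [hf, Finset.sum_pair (by simp only [ne_eq, Prod.mk.injEq]; grind), Sym2.eq_swap (a := b)]
    ring
  · rintro ⟨y, z⟩ hp
    simp only [Finset.mem_offDiag, S, Finset.mem_erase, Finset.mem_univ, and_true] at hp
    simp only [WeightedGraph.reducedEdges, Finset.mem_filter, Finset.mem_univ, true_and,
      Sym2.mk_isDiag_iff, Sym2.mem_iff, not_or]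
    exact ⟨hp.2.2, hp.1.symm, hp.2.1.symm⟩

theorem expect_sq_grad (e : Sym2 V) (f : Perm V → ℝ) :
    expect (fun η => grad e f η ^ 2) =
      2 * (corr f 1 - corr f (transposition e)) / (Fintype.card V).factorial := by
  rw [expect_eq_average, ← sum_sq_translate_sub]
  rfl

/-- The octopus inequality for weights `w` on the vertices different from `x`. -/
theorem sum_corr_swap_le (f : Perm V → ℝ) (x : V) {w : V → ℝ} (hw : ∀ y, y ≠ x → 0 ≤ w y) :
    ∑ y ∈ Finset.univ.erase x, ∑ z ∈ Finset.univ.erase x,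
        w y * w z * (corr f 1 - corr f (swap y z)) ≤
      2 * (∑ y ∈ Finset.univ.erase x, w y) *
        ∑ y ∈ Finset.univ.erase x, w y * (corr f 1 - corr f (swap x y)) := by
  set S : Finset V := Finset.univ.erase x
  set C := ∑ y ∈ S, w y with hC
  have split (g : V → ℝ) : ∑ i, g i = g x + ∑ i ∈ S, g i :=
    (Finset.add_sum_erase _ g (Finset.mem_univ x)).symm
  have hne (y : V) (hy : y ∈ S) : y ≠ x := Finset.ne_of_mem_erase hy
  have hS' (y : V) (hy : y ∈ S) : Function.update w x (-C) y = w y :=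
    Function.update_of_ne (hne y hy) _ _
  -- The weight -C at x balances the others; its square supplies the term C² `corr f 1`.
  have hsum : ∑ i, Function.update w x (-C) i = 0 := by
    rw [split, Finset.sum_congr rfl hS']
    simp [hC]
  have key := sum_mul_corr_swap_nonneg f hsum x fun y hy => by
    rw [Function.update_of_ne hy]; exact hw y hy
  have e1 : ∑ i, ∑ j, Function.update w x (-C) i * Function.update w x (-C) j *
      corr f (swap i j) = C ^ 2 * corr f 1 - 2 * C * ∑ y ∈ S, w y * corr f (swap x y) +
        ∑ y ∈ S, ∑ z ∈ S, w y * w z * corr f (swap y z) := by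
    simp only [split]
    have a1 : ∑ i ∈ S, Function.update w x (-C) x * Function.update w x (-C) i *
        corr f (swap x i) = -C * ∑ y ∈ S, w y * corr f (swap x y) := by
      rw [Finset.mul_sum]
      refine Finset.sum_congr rfl fun y hy => ?_
      rw [hS' y hy, Function.update_self]; ring
    have a2 : ∑ i ∈ S, (Function.update w x (-C) i * Function.update w x (-C) x *
        corr f (swap i x) + ∑ j ∈ S, Function.update w x (-C) i * Function.update w x (-C) j *
        corr f (swap i j)) = -C * ∑ y ∈ S, w y * corr f (swap x y) +
        ∑ y ∈ S, ∑ z ∈ S, w y * w z * corr f (swap y z) := by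
      rw [Finset.mul_sum, ← Finset.sum_add_distrib]
      refine Finset.sum_congr rfl fun y hy => ?_
      rw [hS' y hy, Function.update_self, swap_comm y x]
      congr 1
      · ring
      · exact Finset.sum_congr rfl fun z hz => by rw [hS' z hz]
    rw [a1, a2, Function.update_self, show swap x x = (1 : Perm V) from swap_self x]
    ring
  have e2 : ∑ y ∈ S, ∑ z ∈ S, w y * w z * corr f 1 = C ^ 2 * corr f 1 := by
    simp only [← Finset.sum_mul, ← Finset.mul_sum, ← hC]
    ring
  have e3 : ∑ y ∈ S, w y * corr f 1 = C * corr f 1 := by rw [hC, Finset.sum_mul]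
  simp only [mul_sub, Finset.sum_sub_distrib, e2, e3]
  linarith

end Interchange

theorem theorem2p3 {V : Type*} [Fintype V] [DecidableEq V] (G : WeightedGraph V) (x : V)
    (f : Equiv.Perm V → ℝ) :
    ∑ y ∈ WeightedGraph.reducedVertices x,
        G.c x y * Interchange.expect (fun η => (Interchange.grad s(x, y) f η) ^ 2) ≥
      ∑ e ∈ WeightedGraph.reducedEdges x,
        G.cStar x e * Interchange.expect (fun η => (Interchange.grad e f η) ^ 2) := by
  have hw (y : V) (hy : y ≠ x) : 0 ≤ G.c x y := G.nonneg x y hy.symm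
  have key := Interchange.sum_corr_swap_le f x hw
  have edges := Interchange.sum_reducedEdges x
    (fun e => G.cStar x e * Interchange.expect (fun η => (Interchange.grad e f η) ^ 2))
    fun y => by simp [Interchange.expect_sq_grad, Interchange.transposition,
      show swap y y = (1 : Perm V) from swap_self y, -swap_self]
  set C := ∑ y ∈ Finset.univ.erase x, G.c x y with hC
  set N : ℝ := ((Fintype.card V).factorial : ℝ)
  have hNpos : 0 < N := by positivity
  have hC0 : 0 ≤ C := Finset.sum_nonneg fun y hy => hw y (Finset.ne_of_mem_erase hy)
  have lhs : ∑ y ∈ WeightedGraph.reducedVertices x,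
      G.c x y * Interchange.expect (fun η => (Interchange.grad s(x, y) f η) ^ 2) =
      2 / N * ∑ y ∈ Finset.univ.erase x,
        G.c x y * (Interchange.corr f 1 - Interchange.corr f (swap x y)) := by
    rw [Finset.mul_sum]
    refine Finset.sum_congr rfl fun y _ => ?_
    rw [Interchange.expect_sq_grad]
    change G.c x y * (2 * (_ - Interchange.corr f (swap x y)) / N) = _
    ring
  have rhs : ∑ y ∈ Finset.univ.erase x, ∑ z ∈ Finset.univ.erase x, G.cStar x s(y, z) *
      Interchange.expect (fun η => (Interchange.grad s(y, z) f η) ^ 2) =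
      2 / N / C * ∑ y ∈ Finset.univ.erase x, ∑ z ∈ Finset.univ.erase x,
        G.c x y * G.c x z * (Interchange.corr f 1 - Interchange.corr f (swap y z)) := by
    simp only [Finset.mul_sum]
    refine Finset.sum_congr rfl fun y _ => Finset.sum_congr rfl fun z _ => ?_
    rw [Interchange.expect_sq_grad]
    change G.c x y * G.c x z / C * (2 * (_ - Interchange.corr f (swap y z)) / N) = _
    ring
  rw [rhs] at edges
  rw [ge_iff_le, lhs]
  rcases hC0.eq_or_lt with h0 | h0
  -- If C = 0, all weights at x vanish, and division by zero makes the reduced side 0 as well.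
  · have hz : ∀ y ∈ Finset.univ.erase x, G.c x y = 0 :=
      (Finset.sum_eq_zero_iff_of_nonneg fun y hy => hw y (Finset.ne_of_mem_erase hy)).1 h0.symm
    rw [Finset.sum_eq_zero (s := Finset.univ.erase x) fun y hy => by rw [hz y hy, zero_mul]]
    rw [← h0, div_zero, zero_mul] at edges
    linarith
  · have := mul_le_mul_of_nonneg_left key (a := 2 / N / C) (by positivity)
    rw [edges] at this
    have e : 2 / N / C * (2 * C * ∑ y ∈ Finset.univ.erase x,
        G.c x y * (Interchange.corr f 1 - Interchange.corr f (swap x y))) =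
        2 * (2 / N * ∑ y ∈ Finset.univ.erase x,
        G.c x y * (Interchange.corr f 1 - Interchange.corr f (swap x y))) := by
      field_simp
    linarith
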